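/- For a permutation $\pi\in S_m$, a descent of $\pi$ is a position $i\in\{1,\dots,m-1\}$ with $\pi(i)>\pi(i+1)$. A matching in $S_{2n}$ is a permutation $\pi\in S_{2n}$ with $\pi^2=1$ and $\pi(i)\neq i$ for all $i$. For each $n \ge 1$ let $\pi_n$ be a uniformly random matching in $S_{2n}$, let $D_n$ be the number of descents of $\pi_n$, and put $$W_n=\frac{D_n-n}{\sqrt n}.$$ Let $W$ be a normal random variable with mean $0$ and variance $1/6$. Then the moment generating functions converge pointwise, $$\lim_{n\to\infty}\mathbb E\left[e^{sW_n}\right]=\mathbb E\left[e^{sW}\right]\qquad\text{for every } s\in\mathbb R,$$ and $W_n$ converges to $W$ in distribution, i.e. $W_n\Rightarrow\mathcal N(0,1/6)$. -/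

import Mathlib

open MeasureTheory ProbabilityTheory Filter Topology
open scoped NNReal

/-- Every set of permutations of a finite set is an event. -/
instance Equiv.Perm.instMeasurableSpaceFin (m : ℕ) : MeasurableSpace (Equiv.Perm (Fin m)) := ⊤

instance Equiv.Perm.instDiscreteMeasurableSpaceFin (m : ℕ) :
    DiscreteMeasurableSpace (Equiv.Perm (Fin m)) := ⟨fun _ => trivial⟩

/-- The descent set of `σ`: the positions `i` that have a successor `i + 1` and satisfy
`σ i > σ (i + 1)`. Positions are counted from `0`. -/
def descentSet {m : ℕ} (σ : Equiv.Perm (Fin m)) : Finset (Fin m) :=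
  {i | ∃ h : (i : ℕ) + 1 < m, σ ⟨(i : ℕ) + 1, h⟩ < σ i}

/-- The number of descents of `σ`. -/
def numDescents {m : ℕ} (σ : Equiv.Perm (Fin m)) : ℕ := (descentSet σ).card

/-- The matchings in `S_{2n}`: the involutions without fixed points. -/
def matchings (n : ℕ) : Set (Equiv.Perm (Fin (2 * n))) :=
  {σ | σ ^ 2 = 1 ∧ ∀ i, σ i ≠ i}

/-- The uniform distribution on the matchings in `S_{2n}`. -/
noncomputable def uniformMatching (n : ℕ) : Measure (Equiv.Perm (Fin (2 * n))) :=
  uniformOn (matchings n)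

/-- The normalized number of descents `(D - n) / √n` of a permutation in `S_{2n}`. -/
noncomputable def normalizedDescents (n : ℕ) (σ : Equiv.Perm (Fin (2 * n))) : ℝ :=
  ((numDescents σ : ℝ) - n) / √(n : ℝ)

/-! Counting. Call a word `f` with letters in `{0, …, k}` sorted over `σ` if it is weakly increasing
and jumps strictly at each descent of `σ`; there are `(k + 2n - des σ).choose (2n)` such words. If
`σ` is a matching, the pairs `(f p, f (σ p))` form a swap-invariant multiset without diagonal
entries, that is, a multiset of `n` edges of the complete graph on `k + 1` vertices, and stable
sorting recovers `(σ, f)` from it. Summing over `σ` therefore gives a closed form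
(`sum_choose_numDescents`), a polynomial identity in `k`. Its closed side is invariant under `k ↦ -1
- k`, so `2n - D` satisfies the same identity as `D`.

Asymptotics. Multiplying by `t ^ k` and summing with `t = exp (-a)` expresses `E[t ^ D]` through `∑
edgeProd n k * t ^ k`. Since `edgeProd n k` is close to `k ^ (2n)`, comparison with a Gamma integral
yields `E[exp (-a D)] ≈ ((1 - exp (-a)) / a) ^ (2n + 1)`. After centring at `n` this is essentially
`(sinh (a/2) / (a/2)) ^ (2n + 1)`, which for `a = s / √n` tends to `exp (s² / 12)`, the Gaussian
value for variance `1/6`. The series needs `t < 1`; the other sign of `s` comes from the symmetry.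
Curtiss' theorem then turns convergence of moment generating functions into convergence in
distribution. -/

/-! ### Weakly increasing words and multisets -/

theorem eq_of_monotone_of_map_univ_eq {α : Type*} [PartialOrder α] {m : ℕ} {f g : Fin m → α}
    (hf : Monotone f) (hg : Monotone g)
    (h : (Finset.univ : Finset (Fin m)).val.map f = Finset.univ.val.map g) : f = g := by
  have key : ∀ f : Fin m → α, Finset.univ.val.map f = (List.ofFn f : Multiset α) := by
    intro f
    simp [Fin.univ_val_map]
  rw [key, key, Multiset.coe_eq_coe] at h
  have hs : ∀ {f : Fin m → α}, Monotone f → (List.ofFn f).Pairwise (· ≤ ·) := by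
    intro f hf
    rw [List.pairwise_ofFn]
    exact fun i j hij => hf hij.le
  exact List.ofFn_injective (h.eq_of_pairwise' (hs hf) (hs hg))

theorem exists_monotone_map_univ_eq {α : Type*} [LinearOrder α] {m : ℕ} (s : Multiset α)
    (hs : s.card = m) :
    ∃ f : Fin m → α, Monotone f ∧ (Finset.univ : Finset (Fin m)).val.map f = s := by
  subst hs
  have hl : (s.sort (· ≤ ·)).length = s.card := Multiset.length_sort ..
  refine ⟨fun i => (s.sort (· ≤ ·)).get (i.cast hl.symm), fun i j hij => ?_, ?_⟩
  · have hsorted : (s.sort (· ≤ ·)).Pairwise (· ≤ ·) := Multiset.pairwise_sort ..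
    exact hsorted.sortedLE.monotone_get (by simpa using hij)
  · rw [Fin.univ_val_map]
    conv_rhs => rw [← Multiset.sort_eq s (· ≤ ·)]
    rw [Multiset.coe_eq_coe]
    apply List.Perm.of_eq
    apply List.ext_get
    · simp
    · intro i h1 h2
      simp

theorem card_monotone_fin (m L : ℕ) :
    Nat.card {f : Fin m → Fin L // Monotone f} = (L + m - 1).choose m := by
  have : Nat.card (Sym (Fin L) m) = (L + m - 1).choose m := by
    rw [Nat.card_eq_fintype_card, Sym.card_sym_eq_choose, Fintype.card_fin]
  rw [← this]
  refine Nat.card_congr (Equiv.ofBijective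
    (fun f => (⟨Finset.univ.val.map f.1, by simp⟩ : Sym (Fin L) m)) ⟨?_, ?_⟩)
  · intro f g h
    exact Subtype.ext (eq_of_monotone_of_map_univ_eq f.2 g.2 (congrArg Subtype.val h))
  · intro s
    obtain ⟨f, hf, h⟩ := exists_monotone_map_univ_eq s.1 s.2
    exact ⟨⟨f, hf⟩, Subtype.ext h⟩

/-! ### Words sorted over a permutation -/

/-- `f` is weakly increasing and `σ` is increasing on every fibre of `f`. -/
def IsSortedOver {m : ℕ} {α : Type*} [Preorder α] (σ : Equiv.Perm (Fin m)) (f : Fin m → α) : Prop :=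
  Monotone f ∧ ∀ p q, p < q → f p = f q → σ p < σ q

/-- The number of descents at positions before `p`. -/
def descentsBefore {m : ℕ} (σ : Equiv.Perm (Fin m)) (p : Fin m) : ℕ :=
  ((descentSet σ).filter (· < p)).card

theorem descentsBefore_mono {m : ℕ} (σ : Equiv.Perm (Fin m)) : Monotone (descentsBefore σ) := by
  intro p q h
  apply Finset.card_le_card
  intro i
  simp only [Finset.mem_filter]
  exact fun hi => ⟨hi.1, hi.2.trans_le h⟩

theorem descentsBefore_succ {N : ℕ} (σ : Equiv.Perm (Fin (N + 1))) (p : Fin N) :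
    descentsBefore σ p.succ =
      descentsBefore σ p.castSucc + if σ p.succ < σ p.castSucc then 1 else 0 := by
  have hmem : p.castSucc ∈ descentSet σ ↔ σ p.succ < σ p.castSucc := by
    simp only [descentSet, Finset.mem_filter, Finset.mem_univ, true_and, Fin.val_castSucc]
    constructor
    · rintro ⟨h, h'⟩
      exact h'
    · intro h
      exact ⟨by omega, h⟩
  have hfilter : (descentSet σ).filter (· < p.succ) =
      (descentSet σ).filter (· < p.castSucc) ∪ (descentSet σ).filter (· = p.castSucc) := by
    ext i
    simp only [Finset.mem_filter, Finset.mem_union, Fin.lt_def, Fin.ext_iff, Fin.val_succ,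
      Fin.val_castSucc]
    grind
  rw [descentsBefore, hfilter, Finset.card_union_of_disjoint, Finset.filter_eq']
  · simp only [hmem, descentsBefore]
    split_ifs <;> simp
  · rw [Finset.disjoint_filter]
    intro i _ h1 h2
    exact h1.ne h2

theorem descentsBefore_zero {N : ℕ} (σ : Equiv.Perm (Fin (N + 1))) : descentsBefore σ 0 = 0 := by
  simp [descentsBefore]

theorem descentsBefore_last {N : ℕ} (σ : Equiv.Perm (Fin (N + 1))) :
    descentsBefore σ (Fin.last N) = numDescents σ := by
  rw [descentsBefore, numDescents, Finset.filter_true_of_mem]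
  intro i hi
  simp only [descentSet, Finset.mem_filter, Finset.mem_univ, true_and] at hi
  obtain ⟨h, -⟩ := hi
  rw [Fin.lt_def, Fin.val_last]
  omega

theorem numDescents_le {N : ℕ} (σ : Equiv.Perm (Fin (N + 1))) : numDescents σ ≤ N := by
  have : descentSet σ ⊆ Finset.Iio (Fin.last N) := by
    intro i hi
    simp only [descentSet, Finset.mem_filter, Finset.mem_univ, true_and, Finset.mem_Iio] at hi ⊢
    obtain ⟨h, -⟩ := hi
    rw [Fin.lt_def, Fin.val_last]
    omega
  calc numDescents σ ≤ _ := Finset.card_le_card this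
    _ = N := by simp

/-- Both sides say that `f` rises by at least 1 at each descent and does not fall elsewhere. The
values are taken in `ℤ` to avoid truncated subtraction. -/
theorem isSortedOver_iff {N : ℕ} (σ : Equiv.Perm (Fin (N + 1))) (f : Fin (N + 1) → ℕ) :
    IsSortedOver σ f ↔ Monotone (fun p => (f p : ℤ) - descentsBefore σ p) := by
  rw [Fin.monotone_iff_le_succ]
  simp only [descentsBefore_succ]
  constructor
  · rintro ⟨hf, h⟩ i
    have h1 := hf (Fin.castSucc_le_succ i)
    have h2 := h i.castSucc i.succ (Fin.castSucc_lt_succ)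
    split_ifs with hs
    · have h3 : f i.castSucc ≠ f i.succ := fun e => absurd (h2 e) (not_lt.2 hs.le)
      push_cast
      omega
    · push_cast
      omega
  · intro h
    have hf : Monotone f := by
      rw [Fin.monotone_iff_le_succ]
      intro i
      have := h i
      split_ifs at this <;> push_cast at this <;> omega
    refine ⟨hf, fun p q hpq hfpq => ?_⟩
    have step : ∀ q, p < q → f p = f q → σ p < σ q := by
      intro q
      induction q using Fin.induction with
      | zero => intro h; exact absurd h (Fin.not_lt_zero _)
      | succ i ih =>
        intro hpi e
        have hle : p ≤ i.castSucc := Fin.le_castSucc_iff.2 hpi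
        have e1 : f p = f i.castSucc :=
          le_antisymm (hf hle) (e ▸ hf (Fin.castSucc_le_succ i))
        have hlt : σ i.castSucc < σ i.succ := by
          have := h i
          split_ifs at this with hs
          · push_cast at this; omega
          · refine lt_of_le_of_ne (not_lt.1 hs) fun e => ?_
            exact (Fin.castSucc_lt_succ (i := i)).ne (σ.injective e)
        rcases hle.eq_or_lt with rfl | hlt'
        · exact hlt
        · exact (ih hlt' e1).trans hlt
    exact step q hpq hfpq

/-- Subtracting `descentsBefore σ` is a bijection onto the weakly increasing words with letters in
`{0, …, k - des σ}`. -/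
theorem card_isSortedOver {m : ℕ} (hm : 0 < m) (σ : Equiv.Perm (Fin m)) (k : ℕ) :
    Nat.card {f : Fin m → Fin (k + 1) // IsSortedOver σ f} =
      (k + m - numDescents σ).choose m := by
  obtain ⟨N, rfl⟩ : ∃ N, m = N + 1 := ⟨m - 1, by omega⟩
  have hd := numDescents_le σ
  have hL : (k + (N + 1) - numDescents σ).choose (N + 1) =
      ((k + 1 - numDescents σ) + (N + 1) - 1).choose (N + 1) := by
    -- If `k < numDescents σ`, the truncated subtractions differ, but both binomial coefficients
    -- vanish.
    rcases le_or_gt (numDescents σ) k with h | h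
    · congr 1; omega
    · rw [Nat.choose_eq_zero_of_lt (by omega), Nat.choose_eq_zero_of_lt (by omega)]
  have hval : ∀ f : Fin (N + 1) → Fin (k + 1),
      IsSortedOver σ f ↔ Monotone (fun p => ((f p : ℕ) : ℤ) - descentsBefore σ p) := by
    intro f
    rw [← isSortedOver_iff]
    simp only [IsSortedOver, Monotone, Fin.le_def, Fin.val_inj]
  rw [hL, ← card_monotone_fin]
  have hb : ∀ p, descentsBefore σ p ≤ numDescents σ := fun p => by
    rw [← descentsBefore_last]; exact descentsBefore_mono σ (Fin.le_last p)
  refine Nat.card_congr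
    { toFun := fun f => ⟨fun p => ⟨f.1 p - descentsBefore σ p, ?_⟩, ?_⟩
      invFun := fun g => ⟨fun p => ⟨g.1 p + descentsBefore σ p, ?_⟩, ?_⟩
      left_inv := ?_
      right_inv := ?_ }
  · have h1 := (hval f.1).1 f.2 (Fin.le_last p)
    have h2 := (hval f.1).1 f.2 (Fin.zero_le p)
    have h3 := (f.1 (Fin.last N)).2
    simp only [descentsBefore_last, descentsBefore_zero] at h1 h2
    omega
  · intro p q hpq
    have h1 := (hval f.1).1 f.2 hpq
    simp only [Fin.le_def] at h1 ⊢
    omega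
  · have h1 := (g.1 p).2
    have := hb p
    omega
  · rw [hval]
    intro p q hpq
    have := g.2 hpq
    simp only [Fin.le_def] at this
    simpa using this
  · intro f
    ext p
    have h2 := (hval f.1).1 f.2 (Fin.zero_le p)
    simp only [descentsBefore_zero] at h2
    simp only
    omega
  · intro g
    ext p
    simp

/-! ### Matchings and multisets of unordered pairs -/

section pairs

variable {m K n : ℕ}

/-- The multiset of both orientations of the unordered pairs in `S`. -/
def orientations (S : Multiset {p : Fin K × Fin K // p.1 < p.2}) :
    Multiset (Fin K × Fin K) :=
  S.map Subtype.val + S.map fun p => p.1.swap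

theorem orientations_map_swap (S : Multiset {p : Fin K × Fin K // p.1 < p.2}) :
    (orientations S).map Prod.swap = orientations S := by
  simp [orientations, Multiset.map_map, add_comm]

theorem orientations_filter (S : Multiset {p : Fin K × Fin K // p.1 < p.2}) :
    (orientations S).filter (fun p => p.1 < p.2) = S.map Subtype.val := by
  rw [orientations, Multiset.filter_add, Multiset.filter_eq_self.2, Multiset.filter_eq_nil.2,
    add_zero]
  · intro p hp
    obtain ⟨q, -, rfl⟩ := Multiset.mem_map.1 hp
    exact not_lt.2 q.2.le
  · intro p hp
    obtain ⟨q, -, rfl⟩ := Multiset.mem_map.1 hp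
    exact q.2

theorem orientations_injective :
    Function.Injective (orientations : Multiset {p : Fin K × Fin K // p.1 < p.2} → _) := by
  intro S T h
  have := congrArg (Multiset.filter fun p => p.1 < p.2) h
  rw [orientations_filter, orientations_filter] at this
  exact Multiset.map_injective Subtype.val_injective this

theorem ne_of_mem_orientations {S : Multiset {p : Fin K × Fin K // p.1 < p.2}}
    {p : Fin K × Fin K} (h : p ∈ orientations S) : p.1 ≠ p.2 := by
  rw [orientations, Multiset.mem_add, Multiset.mem_map, Multiset.mem_map] at h
  obtain ⟨q, -, rfl⟩ | ⟨q, -, rfl⟩ := h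
  · exact q.2.ne
  · exact q.2.ne'

theorem card_orientations (S : Multiset {p : Fin K × Fin K // p.1 < p.2}) :
    (orientations S).card = 2 * S.card := by
  simp [orientations, two_mul]

theorem exists_orientations_eq {T : Multiset (Fin K × Fin K)} (hswap : T.map Prod.swap = T)
    (hne : ∀ p ∈ T, p.1 ≠ p.2) :
    ∃ S : Multiset {p : Fin K × Fin K // p.1 < p.2}, orientations S = T := by
  have hlift : ∃ S : Multiset {p : Fin K × Fin K // p.1 < p.2},
      S.map Subtype.val = T.filter fun p => p.1 < p.2 := by
    refine ⟨(T.filter fun p => p.1 < p.2).attach.map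
      fun p => ⟨p.1, Multiset.of_mem_filter (p := fun p : Fin K × Fin K => p.1 < p.2) p.2⟩, ?_⟩
    rw [Multiset.map_map]
    exact Multiset.attach_map_val _
  obtain ⟨S, hS⟩ := hlift
  refine ⟨S, ?_⟩
  have h2 : (S.map fun p => p.1.swap) = (S.map Subtype.val).map Prod.swap := by
    rw [Multiset.map_map]; rfl
  rw [orientations, h2, hS, Multiset.map_filter' _ Prod.swap_injective, hswap]
  conv_rhs => rw [← Multiset.filter_add_not (fun p => p.1 < p.2) T]
  congr 1
  refine Multiset.filter_congr fun p hp => ?_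
  have := hne p hp
  constructor
  · rintro ⟨q, hq, rfl⟩
    exact not_lt.2 hq.le
  · intro h
    exact ⟨p.swap, lt_of_le_of_ne (not_lt.1 h) this.symm, Prod.swap_swap p⟩

theorem IsSortedOver.monotone_toLex {σ : Equiv.Perm (Fin m)} {f : Fin m → Fin K}
    (h : IsSortedOver σ f) : Monotone fun p => toLex (f p, f (σ p)) := by
  intro p q hpq
  rcases hpq.eq_or_lt with rfl | hlt
  · exact le_rfl
  rw [Prod.Lex.toLex_le_toLex]
  rcases (h.1 hpq).lt_or_eq with h1 | h1
  · exact Or.inl h1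
  · exact Or.inr ⟨h1, h.1 (h.2 p q hlt h1).le⟩

theorem IsSortedOver.eq_sort {σ : Equiv.Perm (Fin m)} {f g : Fin m → Fin K}
    (h : IsSortedOver σ f) (hg : g ∘ σ = f) : σ = Tuple.sort g := by
  subst hg
  exact Tuple.eq_sort_iff.2 h

/-- The multiset of the pairs `(f p, f (σ p))`. -/
def pairMultiset (σ : Equiv.Perm (Fin m)) (f : Fin m → Fin K) : Multiset (Fin K × Fin K) :=
  Finset.univ.val.map fun p => (f p, f (σ p))

theorem map_univ_comp_perm {α : Type*} (σ : Equiv.Perm (Fin m)) (f : Fin m → α) :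
    (Finset.univ : Finset (Fin m)).val.map (fun p => f (σ p)) = Finset.univ.val.map f := by
  rw [← Function.comp_def f σ, ← Multiset.map_map, Multiset.map_univ_val_equiv]

/-- The sequence `(f p, f (σ p))` is lexicographically sorted, hence determined by its multiset.
This gives `f` and `f ∘ σ`; as `σ` is an involution it is the stable sort of `f ∘ σ`. -/
theorem pairMultiset_injOn {σ τ : Equiv.Perm (Fin m)} {f g : Fin m → Fin K}
    (hσ : σ ^ 2 = 1) (hτ : τ ^ 2 = 1) (hf : IsSortedOver σ f) (hg : IsSortedOver τ g)
    (h : pairMultiset σ f = pairMultiset τ g) : σ = τ ∧ f = g := by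
  have h2 := congrArg (Multiset.map toLex) h
  simp only [pairMultiset, Multiset.map_map] at h2
  have h3 := eq_of_monotone_of_map_univ_eq hf.monotone_toLex hg.monotone_toLex h2
  have h4 : ∀ p, f p = g p ∧ f (σ p) = g (τ p) := fun p =>
    Prod.ext_iff.1 (toLex.injective (congrFun h3 p))
  have hfg : f = g := funext fun p => (h4 p).1
  refine ⟨?_, hfg⟩
  have e1 : (fun p => f (σ p)) ∘ σ = f := by
    funext p
    simp [← Equiv.Perm.mul_apply, ← sq, hσ]
  have e2 : (fun p => f (σ p)) ∘ τ = g := by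
    funext p
    simp [(h4 _).2, ← Equiv.Perm.mul_apply, ← sq, hτ]
  rw [hf.eq_sort e1, hg.eq_sort e2]

theorem pairMultiset_map_swap {σ : Equiv.Perm (Fin m)} (hσ : σ ^ 2 = 1) (f : Fin m → Fin K) :
    (pairMultiset σ f).map Prod.swap = pairMultiset σ f := by
  rw [pairMultiset, Multiset.map_map]
  conv_rhs => rw [← map_univ_comp_perm σ]
  simp [← Equiv.Perm.mul_apply, ← sq, hσ]

/-- If `i` and `σ i` were distinct points of one fibre of `f`, then `σ` would exchange them, whereas
it increases on fibres. -/
theorem ne_of_mem_pairMultiset {σ : Equiv.Perm (Fin m)} {f : Fin m → Fin K}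
    (hσ : σ ^ 2 = 1) (hfix : ∀ i, σ i ≠ i) (hf : IsSortedOver σ f) :
    ∀ p ∈ pairMultiset σ f, p.1 ≠ p.2 := by
  intro p hp
  obtain ⟨i, -, rfl⟩ := Multiset.mem_map.1 hp
  intro e
  have hinv : σ (σ i) = i := by simp [← Equiv.Perm.mul_apply, ← sq, hσ]
  rcases lt_or_gt_of_ne (hfix i) with h | h
  · have := hf.2 _ _ h e.symm
    rw [hinv] at this
    exact this.not_gt h
  · have := hf.2 _ _ h e
    rw [hinv] at this
    exact this.not_gt h

/-- List `T` lexicographically as `(f p, g p)` and let `σ` be the stable sort of `g`. Swap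
invariance makes `σ` exchange `f` and `g`; uniqueness of the stable sort makes it an involution; a
fixed point would be a diagonal pair. -/
theorem exists_pairMultiset_eq {T : Multiset (Fin K × Fin K)} (hcard : T.card = m)
    (hswap : T.map Prod.swap = T) (hne : ∀ p ∈ T, p.1 ≠ p.2) :
    ∃ (σ : Equiv.Perm (Fin m)) (f : Fin m → Fin K), σ ^ 2 = 1 ∧ (∀ i, σ i ≠ i) ∧
      IsSortedOver σ f ∧ pairMultiset σ f = T := by
  obtain ⟨h, hmono, hT⟩ := exists_monotone_map_univ_eq (m := m) (T.map toLex) (by simpa)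
  set f : Fin m → Fin K := fun p => (ofLex (h p)).1 with hf
  set g : Fin m → Fin K := fun p => (ofLex (h p)).2 with hg
  have hT' : (Finset.univ : Finset (Fin m)).val.map (fun p => (f p, g p)) = T := by
    have := congrArg (Multiset.map ofLex) hT
    simpa [Multiset.map_map, Function.comp_def] using this
  have hlex : ∀ p q, p ≤ q → f p < f q ∨ f p = f q ∧ g p ≤ g q := by
    intro p q hpq
    exact (Prod.Lex.le_iff).1 (hmono hpq)
  have hfmono : Monotone f := fun p q hpq => by
    rcases hlex p q hpq with h | h
    exacts [h.le, h.1.le]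
  set σ := Tuple.sort g with hσ
  obtain ⟨hs1, hs2⟩ := Tuple.eq_sort_iff.1 hσ
  -- By swap invariance `f` and `g` take the same values with multiplicity.
  have hgσ : g ∘ σ = f := by
    apply eq_of_monotone_of_map_univ_eq hs1 hfmono
    rw [Function.comp_def, map_univ_comp_perm]
    have h1 := congrArg (Multiset.map Prod.fst) hswap
    rw [Multiset.map_map, ← hT', Multiset.map_map, Multiset.map_map] at h1
    exact h1
  have hgσ' : ∀ p, g (σ p) = f p := fun p => congrFun hgσ p
  have hsorted : IsSortedOver σ f :=
    ⟨hfmono, fun p q hpq e => hs2 p q hpq (by rw [hgσ', hgσ', e])⟩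
  have hfσ : (fun p => toLex (f p, f (σ p))) = h := by
    apply eq_of_monotone_of_map_univ_eq hsorted.monotone_toLex hmono
    rw [hT]
    have h1 : (Finset.univ : Finset (Fin m)).val.map (fun p => (f p, f (σ p))) = T :=
      calc _ = (Finset.univ : Finset (Fin m)).val.map (fun p => (g (σ p), f (σ p))) := by
            simp only [hgσ']
        _ = Finset.univ.val.map (fun p => (g p, f p)) :=
            map_univ_comp_perm σ fun p => (g p, f p)
        _ = T.map Prod.swap := by rw [← hT', Multiset.map_map]; rfl
        _ = T := hswap
    rw [← h1, Multiset.map_map]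
    rfl
  have hfσ' : ∀ p, f (σ p) = g p := fun p => congrArg (fun x => (ofLex x).2) (congrFun hfσ p)
  -- The inverse also sorts `g`, and it keeps ties in order because `f` is monotone and `σ`
  -- increases on its fibres.
  have hinv : σ⁻¹ = Tuple.sort g := by
    rw [Tuple.eq_sort_iff]
    have e : ∀ p, g (σ⁻¹ p) = f p := fun p => by
      rw [← hfσ']; simp
    constructor
    · intro p q hpq
      simp only [Function.comp_apply, e]
      exact hfmono hpq
    · intro i j hij hgij
      rw [e, e] at hgij
      by_contra hcon
      have hlt : σ⁻¹ j < σ⁻¹ i :=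
        lt_of_le_of_ne (not_lt.1 hcon) (fun h => hij.ne' (σ⁻¹.injective h))
      have ej : f (σ⁻¹ j) = g j := by rw [← hgσ']; simp
      have ei : f (σ⁻¹ i) = g i := by rw [← hgσ']; simp
      have h1 : g i ≤ g j := by
        rcases hlex i j hij.le with h | h
        · exact absurd hgij h.ne
        · exact h.2
      have h2 : g j ≤ g i := by
        rw [← ej, ← ei]; exact hfmono hlt.le
      have h3 := hsorted.2 _ _ hlt (by rw [ej, ei]; exact le_antisymm h2 h1)
      simp at h3
      exact h3.not_gt hij
  refine ⟨σ, f, ?_, ?_, hsorted, ?_⟩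
  · rw [sq]
    nth_rewrite 1 [hσ]
    rw [← hinv, inv_mul_cancel]
  · intro i hi
    have hmem : (f i, g i) ∈ T := by
      rw [← hT']
      exact Multiset.mem_map_of_mem _ (Finset.mem_univ i)
    apply hne _ hmem
    change f i = g i
    rw [← hfσ', hi]
  · rw [← hT', pairMultiset]
    simp only [hfσ']

end pairs

/-! ### The counting identity -/

/-- The matchings in `S_{2n}`, as a finite set. -/
def matchingFinset (n : ℕ) : Finset (Equiv.Perm (Fin (2 * n))) :=
  {σ | σ ^ 2 = 1 ∧ ∀ i, σ i ≠ i}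

theorem mem_matchingFinset {n : ℕ} {σ : Equiv.Perm (Fin (2 * n))} :
    σ ∈ matchingFinset n ↔ σ ^ 2 = 1 ∧ ∀ i, σ i ≠ i := by
  simp [matchingFinset]

theorem card_lt_pairs (K : ℕ) :
    Nat.card {p : Fin K × Fin K // p.1 < p.2} = K.choose 2 := by
  have : (∑ j : Fin K, (j : ℕ)) = K.choose 2 := by
    rw [Fin.sum_univ_eq_sum_range (fun i => i), Finset.sum_range_id, Nat.choose_two_right]
  rw [← this, Nat.card_eq_fintype_card, Fintype.card_subtype, Finset.card_filter,
    Fintype.sum_prod_type_right]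
  refine Finset.sum_congr rfl fun j _ => ?_
  rw [← Finset.card_filter, ← Fin.card_Iio]
  congr 1
  ext
  simp

theorem sum_choose_numDescents {n : ℕ} (hn : 0 < n) (k : ℕ) :
    ∑ σ ∈ matchingFinset n, (k + 2 * n - numDescents σ).choose (2 * n) =
      ((k + 1).choose 2 + n - 1).choose n := by
  have h1 : Nat.card (Sym {p : Fin (k + 1) × Fin (k + 1) // p.1 < p.2} n) =
      ((k + 1).choose 2 + n - 1).choose n := by
    rw [Nat.card_eq_fintype_card, Sym.card_sym_eq_choose, ← Nat.card_eq_fintype_card,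
      card_lt_pairs]
  have h2 : Nat.card (Σ σ : matchingFinset n,
      {f : Fin (2 * n) → Fin (k + 1) // IsSortedOver σ.1 f}) =
      ∑ σ ∈ matchingFinset n, (k + 2 * n - numDescents σ).choose (2 * n) := by
    rw [Nat.card_sigma, ← Finset.sum_coe_sort (matchingFinset n)]
    exact Finset.sum_congr rfl fun σ _ => card_isSortedOver (by omega) σ.1 k
  rw [← h1, ← h2]
  have hex : ∀ S : Sym {p : Fin (k + 1) × Fin (k + 1) // p.1 < p.2} n,
      ∃ x : (Σ σ : matchingFinset n, {f : Fin (2 * n) → Fin (k + 1) // IsSortedOver σ.1 f}),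
        pairMultiset x.1.1 x.2.1 = orientations S.1 := by
    intro S
    obtain ⟨σ, f, hs, hfix, hsort, h⟩ := exists_pairMultiset_eq (m := 2 * n)
      (by rw [card_orientations, S.2]) (orientations_map_swap S.1)
      (fun p => ne_of_mem_orientations)
    exact ⟨⟨⟨σ, mem_matchingFinset.2 ⟨hs, hfix⟩⟩, ⟨f, hsort⟩⟩, h⟩
  -- `F` is injective since `orientations` is, and surjective since `pairMultiset` determines `(σ,
  -- f)`.
  choose F hF using hex
  refine (Nat.card_congr (Equiv.ofBijective F ⟨?_, ?_⟩)).symm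
  · intro S T h
    apply Subtype.ext
    apply orientations_injective
    rw [← hF, ← hF, h]
  · rintro ⟨⟨σ, hσ⟩, ⟨f, hf⟩⟩
    obtain ⟨hs, hfix⟩ := mem_matchingFinset.1 hσ
    obtain ⟨S, hS⟩ := exists_orientations_eq (pairMultiset_map_swap hs f)
      (ne_of_mem_pairMultiset hs hfix hf)
    have hc : S.card = n := by
      have := congrArg Multiset.card hS
      rw [card_orientations, pairMultiset, Multiset.card_map] at this
      simpa using this
    refine ⟨⟨S, hc⟩, ?_⟩
    have e := hF ⟨S, hc⟩
    generalize F ⟨S, hc⟩ = x at e ⊢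
    obtain ⟨⟨τ, hτ⟩, ⟨g, hg⟩⟩ := x
    obtain ⟨rfl, rfl⟩ := pairMultiset_injOn (mem_matchingFinset.1 hτ).1 hs hg hf (e.trans hS)
    rfl

/-! ### Extension to real arguments and the symmetry of descents -/

open Nat in
theorem prod_range_eq_factorial_mul_choose {N d : ℕ} (k : ℕ) (hd : d ≤ N) :
    ∏ i ∈ Finset.range N, ((k : ℝ) + 1 - d + i) = N ! * (k + N - d).choose N := by
  rw [← Nat.cast_mul, ← Nat.descFactorial_eq_factorial_mul_choose,
    ← descPochhammer_eval_eq_descFactorial, descPochhammer_eval_eq_prod_range,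
    ← Finset.prod_range_reflect]
  refine Finset.prod_congr rfl fun i hi => ?_
  have hi : i + 1 ≤ N := Finset.mem_range.1 hi
  rw [Nat.cast_sub (by omega : d ≤ k + N), show N - 1 - i = N - (i + 1) by omega,
    Nat.cast_sub hi]
  push_cast
  ring

/-- The polynomial `∏ (x (x + 1) + 2 j)`, whose value at `k` is up to a constant the number of
multisets of `n` edges of the complete graph on `k + 1` vertices. -/
def edgeProd (n : ℕ) (x : ℝ) : ℝ := ∏ j ∈ Finset.range n, (x * (x + 1) + 2 * j)

theorem edgeProd_neg_one_sub (n : ℕ) (x : ℝ) : edgeProd n (-1 - x) = edgeProd n x := by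
  unfold edgeProd
  congr! 2
  ring

open Nat in
theorem edgeProd_natCast (n k : ℕ) :
    edgeProd n k = 2 ^ n * n ! * ((k + 1).choose 2 + n - 1).choose n := by
  have h : ((k + 1).choose 2 : ℝ) = k * (k + 1) / 2 := by
    rw [Nat.cast_choose_two]; push_cast; ring
  rw [mul_assoc, ← Nat.cast_mul, ← Nat.ascFactorial_eq_factorial_mul_choose',
    Nat.ascFactorial_eq_prod_range, edgeProd]
  push_cast
  rw [h, ← Finset.card_range n, ← Finset.prod_const, Finset.card_range, ← Finset.prod_mul_distrib]
  refine Finset.prod_congr rfl fun j _ => ?_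
  ring

theorem numDescents_le_two_mul {n : ℕ} (σ : Equiv.Perm (Fin (2 * n))) :
    numDescents σ ≤ 2 * n :=
  (Finset.card_le_univ _).trans (by simp)

section polynomial
open Polynomial

-- Both sides agree at every natural number by the counting identity. As polynomials they may then
-- be evaluated at any real, in particular at `-1 - x`.
open Nat in
theorem polynomial_identity {n : ℕ} (hn : 0 < n) :
    C ((2 : ℝ) ^ n * n !) * ∑ σ ∈ matchingFinset n,
        ∏ i ∈ Finset.range (2 * n), (X + C ((1 : ℝ) - numDescents σ + i)) =
      C (((2 * n)! : ℕ) : ℝ) * ∏ j ∈ Finset.range n, (X * (X + 1) + C (2 * (j : ℝ))) := by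
  apply Polynomial.eq_of_infinite_eval_eq
  refine (Set.infinite_range_of_injective (Nat.cast_injective (R := ℝ))).mono ?_
  rintro _ ⟨k, rfl⟩
  have h1 := edgeProd_natCast n k
  rw [← sum_choose_numDescents hn] at h1
  simp only [edgeProd] at h1
  simp only [Set.mem_ofPred_eq, eval_mul, eval_C, eval_finsetSum, eval_prod, eval_add, eval_X,
    eval_one, h1]
  have h2 : ∀ σ : Equiv.Perm (Fin (2 * n)), ∏ i ∈ Finset.range (2 * n),
      ((k : ℝ) + (1 - numDescents σ + i)) =
        (2 * n)! * (k + 2 * n - numDescents σ).choose (2 * n) := by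
    intro σ
    rw [← prod_range_eq_factorial_mul_choose k (numDescents_le_two_mul σ)]
    exact Finset.prod_congr rfl fun i _ => by ring
  simp only [h2, ← Finset.mul_sum]
  push_cast
  ring

-- Comparison of the coefficients of `X ^ (2n)`: every product in `polynomial_identity` is monic of
-- degree `2n`.
open Nat in
theorem card_matchingFinset {n : ℕ} (hn : 0 < n) :
    (2 : ℝ) ^ n * n ! * (matchingFinset n).card = (2 * n)! := by
  have h := congrArg (fun p => p.coeff (2 * n)) (polynomial_identity hn)
  simp only [coeff_C_mul, finsetSum_coeff] at h
  have h1 : ∀ σ : Equiv.Perm (Fin (2 * n)), (∏ i ∈ Finset.range (2 * n),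
      (X + C ((1 : ℝ) - numDescents σ + i))).coeff (2 * n) = 1 := by
    intro σ
    have hm : ∀ i ∈ Finset.range (2 * n), (X + C ((1 : ℝ) - numDescents σ + i)).Monic :=
      fun i _ => monic_X_add_C _
    have hdeg := natDegree_prod_of_monic _ _ hm
    simp only [natDegree_X_add_C, Finset.sum_const, Finset.card_range, smul_eq_mul,
      mul_one] at hdeg
    have hc := (monic_prod_of_monic _ _ hm).coeff_natDegree
    rwa [hdeg] at hc
  have h2 : (∏ j ∈ Finset.range n, (X * (X + 1) + C (2 * (j : ℝ)))).coeff (2 * n) = 1 := by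
    have hd : ∀ c : ℝ, (X * (X + 1) + C c).natDegree = 2 := fun c => by compute_degree!
    have hm : ∀ j ∈ Finset.range n, (X * (X + 1) + C (2 * (j : ℝ))).Monic :=
      fun j _ => by monicity!
    have hdeg := natDegree_prod_of_monic _ _ hm
    simp only [hd, Finset.sum_const, Finset.card_range, smul_eq_mul, mul_comm n] at hdeg
    have hc := (monic_prod_of_monic _ _ hm).coeff_natDegree
    rwa [hdeg] at hc
  simpa only [h1, h2, Finset.sum_const, nsmul_eq_mul, mul_one] using h

end polynomial

theorem card_matchingFinset_pos {n : ℕ} (hn : 0 < n) : 0 < ((matchingFinset n).card : ℝ) := by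
  have h := card_matchingFinset hn
  have : (0 : ℝ) < (2 * n).factorial := by positivity
  rw [← h] at this
  exact pos_of_mul_pos_right this (by positivity)

theorem sum_prod_numDescents {n : ℕ} (hn : 0 < n) (x : ℝ) :
    ∑ σ ∈ matchingFinset n, ∏ i ∈ Finset.range (2 * n), (x + 1 - numDescents σ + i) =
      (matchingFinset n).card * edgeProd n x := by
  have h := congrArg (Polynomial.eval x) (polynomial_identity hn)
  rw [← card_matchingFinset hn] at h
  simp only [Polynomial.eval_mul, Polynomial.eval_C, Polynomial.eval_finsetSum,
    Polynomial.eval_prod, Polynomial.eval_add, Polynomial.eval_X, Polynomial.eval_one] at h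
  rw [mul_assoc ((2 : ℝ) ^ n * n.factorial)] at h
  have h' := mul_left_cancel₀ (by positivity : (2 : ℝ) ^ n * n.factorial ≠ 0) h
  rw [edgeProd, ← h']
  simp only [add_sub_assoc, add_assoc]

/-- Reversing the order of the factors matches each with the negative of one on the other side; the
signs cancel because `N` is even. -/
theorem prod_range_reflect_of_even {N d : ℕ} (hN : Even N) (hd : d ≤ N) (x : ℝ) :
    ∏ i ∈ Finset.range N, (x + 1 - (N - d : ℕ) + i) =
      ∏ i ∈ Finset.range N, (-1 - x + 1 - d + i) := by
  have h : ∏ i ∈ Finset.range N, (x + 1 - (N - d : ℕ) + i) =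
      ∏ i ∈ Finset.range N, ((-1) * (-1 - x + 1 - d + (N - 1 - i : ℕ))) := by
    refine Finset.prod_congr rfl fun i hi => ?_
    have hi : i + 1 ≤ N := Finset.mem_range.1 hi
    rw [Nat.cast_sub hd, show N - 1 - i = N - (i + 1) by omega, Nat.cast_sub hi]
    push_cast
    ring
  rw [h, Finset.prod_mul_distrib, Finset.prod_const, Finset.card_range, hN.neg_one_pow, one_mul,
    Finset.prod_range_reflect (fun i => -1 - x + 1 - d + (i : ℝ))]

theorem sum_prod_two_mul_sub_numDescents {n : ℕ} (hn : 0 < n) (x : ℝ) :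
    ∑ σ ∈ matchingFinset n,
        ∏ i ∈ Finset.range (2 * n), (x + 1 - (2 * n - numDescents σ : ℕ) + i) =
      (matchingFinset n).card * edgeProd n x := by
  rw [← edgeProd_neg_one_sub, ← sum_prod_numDescents hn]
  refine Finset.sum_congr rfl fun σ _ => ?_
  exact prod_range_reflect_of_even (even_two_mul n) (numDescents_le_two_mul σ) x

/-! ### Generating functions -/

open Nat in
theorem hasSum_prod_range_mul_pow {N d : ℕ} (hd : d ≤ N) {t : ℝ} (ht : |t| < 1) :
    HasSum (fun k : ℕ => (∏ i ∈ Finset.range N, ((k : ℝ) + 1 - d + i)) * t ^ k)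
      (N ! * t ^ d / (1 - t) ^ (N + 1)) := by
  simp only [prod_range_eq_factorial_mul_choose _ hd]
  -- The first `d` terms vanish, because `k + N - d < N` for `k < d`.
  rw [← hasSum_nat_add_iff' d, Finset.sum_eq_zero, sub_zero]
  · have h := (hasSum_choose_mul_geometric_of_norm_lt_one N (r := t) ht).mul_left (N ! * t ^ d : ℝ)
    rw [mul_one_div] at h
    convert! h using 2 with k
    rw [show k + d + N - d = k + N by omega]
    ring
  · intro k hk
    rw [Nat.choose_eq_zero_of_lt (by have := Finset.mem_range.1 hk; omega)]
    simp

-- The statistic `d` is left general so as to cover both `numDescents` and `2 * n - numDescents`.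
open Nat in
theorem hasSum_edgeProd {n : ℕ} (d : Equiv.Perm (Fin (2 * n)) → ℕ) (hd : ∀ σ, d σ ≤ 2 * n)
    (hn : 0 < n)
    (hsum : ∀ x : ℝ, ∑ σ ∈ matchingFinset n, ∏ i ∈ Finset.range (2 * n), (x + 1 - d σ + i) =
      (matchingFinset n).card * edgeProd n x) {t : ℝ} (ht : |t| < 1) :
    HasSum (fun k : ℕ => edgeProd n k * t ^ k)
      ((2 * n)! / (1 - t) ^ (2 * n + 1) *
        ((∑ σ ∈ matchingFinset n, t ^ d σ) / (matchingFinset n).card)) := by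
  have h := (hasSum_sum fun σ (_ : σ ∈ matchingFinset n) =>
    hasSum_prod_range_mul_pow (hd σ) ht).mul_left ((matchingFinset n).card : ℝ)⁻¹
  have hc := (card_matchingFinset_pos hn).ne'
  convert! h using 1
  · funext k
    rw [← Finset.sum_mul, hsum]
    field_simp
  · rw [← Finset.sum_div, ← Finset.mul_sum]
    ring

/-! ### Power sums against Gamma integrals -/

section comparison
open Nat Real

theorem integral_pow_mul_exp_neg_mul_Ioi (m : ℕ) {a : ℝ} (ha : 0 < a) :
    ∫ y in Set.Ioi 0, y ^ m * exp (-(a * y)) = m ! / a ^ (m + 1) := by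
  have h := Real.integral_rpow_mul_exp_neg_mul_Ioi (a := m + 1) (by positivity) ha
  rw [Real.Gamma_nat_eq_factorial, add_sub_cancel_right] at h
  norm_cast at h
  rw [h, one_div, inv_pow, div_eq_mul_inv, mul_comm]

theorem integrableOn_pow_mul_exp_neg_mul_Ioi (m : ℕ) {a : ℝ} (ha : 0 < a) :
    IntegrableOn (fun y : ℝ => y ^ m * exp (-(a * y))) (Set.Ioi 0) := by
  refine Integrable.of_integral_ne_zero ?_
  rw [integral_pow_mul_exp_neg_mul_Ioi m ha]
  positivity

theorem sum_range_integral_pow_mul_exp (m N : ℕ) (a c : ℝ) :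
    ∑ k ∈ Finset.range N, ∫ y in (k + c)..(k + 1 + c), y ^ m * exp (-(a * y)) =
      ∫ y in c..(N + c), y ^ m * exp (-(a * y)) := by
  have h := intervalIntegral.sum_integral_adjacent_intervals (μ := volume)
    (f := fun y : ℝ => y ^ m * exp (-(a * y))) (a := fun k : ℕ => (k : ℝ) + c) (n := N)
    (fun k _ => Continuous.intervalIntegrable (by fun_prop) _ _)
  simpa using h

theorem sum_range_succ_pow_mul_exp_le (m N : ℕ) {a : ℝ} (ha : 0 < a) :
    ∑ k ∈ Finset.range N, ((k : ℝ) + 1) ^ m * exp (-a) ^ k ≤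
      exp (2 * a) * (m ! / a ^ (m + 1)) := by
  -- On `[k + 1, k + 2]` the power is at least `(k + 1) ^ m`, and the exponential loses at most the
  -- factor `exp (2 * a)`. No unimodality of the integrand is needed.
  have hterm : ∀ k : ℕ, ((k : ℝ) + 1) ^ m * exp (-a) ^ k ≤
      exp (2 * a) * ∫ y in (k + 1 : ℝ)..(k + 1 + 1), y ^ m * exp (-(a * y)) := by
    intro k
    have hc : ∫ y in (k + 1 : ℝ)..(k + 1 + 1), ((k : ℝ) + 1) ^ m * exp (-a) ^ k =
        ((k : ℝ) + 1) ^ m * exp (-a) ^ k := by simp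
    rw [← hc, ← intervalIntegral.integral_const_mul]
    refine intervalIntegral.integral_mono_on (by linarith)
      (Continuous.intervalIntegrable (by fun_prop) _ _)
      (Continuous.intervalIntegrable (by fun_prop) _ _) fun y hy => ?_
    rw [← Real.exp_nat_mul, mul_left_comm, ← Real.exp_add]
    have hpow : ((k : ℝ) + 1) ^ m ≤ y ^ m := pow_le_pow_left₀ (by positivity) hy.1 m
    refine mul_le_mul hpow (Real.exp_le_exp.2 ?_) (exp_pos _).le
      ((by positivity : (0 : ℝ) ≤ ((k : ℝ) + 1) ^ m).trans hpow)
    nlinarith [hy.2]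
  calc _ ≤ _ := Finset.sum_le_sum fun k _ => hterm k
    _ = exp (2 * a) * ∫ y in (1 : ℝ)..(N + 1), y ^ m * exp (-(a * y)) := by
      rw [← Finset.mul_sum, sum_range_integral_pow_mul_exp]
    _ ≤ _ := by
      rw [← integral_pow_mul_exp_neg_mul_Ioi m ha, intervalIntegral.integral_of_le (by simp)]
      refine mul_le_mul_of_nonneg_left ?_ (exp_pos _).le
      refine setIntegral_mono_set (integrableOn_pow_mul_exp_neg_mul_Ioi m ha) ?_ ?_
      · refine (ae_restrict_mem measurableSet_Ioi).mono fun y hy => ?_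
        have : (0 : ℝ) < y := hy
        simp only [Pi.zero_apply]
        positivity
      · refine LE.le.eventuallyLE fun y (hy : y ∈ Set.Ioc _ _) => ?_
        exact zero_lt_one.trans hy.1

theorem summable_succ_pow_mul_exp (m : ℕ) {a : ℝ} (ha : 0 < a) :
    Summable fun k : ℕ => ((k : ℝ) + 1) ^ m * exp (-a) ^ k :=
  summable_of_sum_range_le (fun k => by positivity)
    (fun N => sum_range_succ_pow_mul_exp_le m N ha)

theorem tsum_succ_pow_mul_exp_le (m : ℕ) {a : ℝ} (ha : 0 < a) :
    ∑' k : ℕ, ((k : ℝ) + 1) ^ m * exp (-a) ^ k ≤ exp (2 * a) * (m ! / a ^ (m + 1)) :=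
  Real.tsum_le_of_sum_range_le (fun k => by positivity)
    (fun N => sum_range_succ_pow_mul_exp_le m N ha)

theorem le_tsum_succ_pow_mul_exp (m : ℕ) {a : ℝ} (ha : 0 < a) :
    m ! / a ^ (m + 1) ≤ ∑' k : ℕ, ((k : ℝ) + 1) ^ m * exp (-a) ^ k := by
  have hterm : ∀ k : ℕ, ∫ y in (k + 0 : ℝ)..(k + 1 + 0), y ^ m * exp (-(a * y)) ≤
      ((k : ℝ) + 1) ^ m * exp (-a) ^ k := by
    intro k
    have hc : ∫ y in (k + 0 : ℝ)..(k + 1 + 0), ((k : ℝ) + 1) ^ m * exp (-a) ^ k =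
        ((k : ℝ) + 1) ^ m * exp (-a) ^ k := by simp
    rw [← hc]
    refine intervalIntegral.integral_mono_on (by linarith)
      (Continuous.intervalIntegrable (by fun_prop) _ _)
      (Continuous.intervalIntegrable (by fun_prop) _ _) fun y hy => ?_
    have hy0 : 0 ≤ y := by have := hy.1; have : (0 : ℝ) ≤ k := k.cast_nonneg; linarith
    rw [← Real.exp_nat_mul]
    gcongr
    · linarith [hy.2]
    · nlinarith [hy.1]
  rw [← integral_pow_mul_exp_neg_mul_Ioi m ha]
  refine le_of_tendsto (intervalIntegral_tendsto_integral_Ioi 0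
    (integrableOn_pow_mul_exp_neg_mul_Ioi m ha) tendsto_natCast_atTop_atTop)
    (Eventually.of_forall fun N => ?_)
  have h := sum_range_integral_pow_mul_exp m N a 0
  rw [add_zero] at h
  rw [← h]
  refine (Finset.sum_le_sum fun k _ => hterm k).trans ?_
  exact (summable_succ_pow_mul_exp m ha).sum_le_tsum _ fun k _ => by positivity

end comparison

/-! ### Bounds for `edgeProd` and its generating function -/

theorem pow_le_edgeProd (n : ℕ) {x : ℝ} (hx : 0 ≤ x) : x ^ (2 * n) ≤ edgeProd n x := by
  rw [pow_mul, ← Finset.card_range n, ← Finset.prod_const, Finset.card_range]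
  refine Finset.prod_le_prod (fun _ _ => by positivity) fun j _ => ?_
  have : (0 : ℝ) ≤ j := j.cast_nonneg
  nlinarith

theorem edgeProd_nonneg (n : ℕ) {x : ℝ} (hx : 0 ≤ x) : 0 ≤ edgeProd n x :=
  (by positivity : (0 : ℝ) ≤ x ^ (2 * n)).trans (pow_le_edgeProd n hx)

/-- After squaring, the factors `j` and `n - 1 - j` are paired and AM-GM replaces `2 * j` by its
mean `n - 1`. -/
theorem edgeProd_le (n : ℕ) {x : ℝ} (hx : 0 ≤ x) : edgeProd n x ≤ ((x + 1) ^ 2 + n) ^ n := by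
  refine le_of_sq_le_sq ?_ (by positivity)
  have h : edgeProd n x ^ 2 = ∏ j ∈ Finset.range n,
      ((x * (x + 1) + 2 * j) * (x * (x + 1) + 2 * (n - 1 - j : ℕ))) := by
    rw [sq, Finset.prod_mul_distrib,
      Finset.prod_range_reflect (fun j : ℕ => x * (x + 1) + 2 * (j : ℝ)), edgeProd]
  rw [h, ← pow_mul, mul_comm n, pow_mul]
  have hp : (((x + 1) ^ 2 + (n : ℝ)) ^ 2) ^ n =
      ∏ _j ∈ Finset.range n, ((x + 1) ^ 2 + (n : ℝ)) ^ 2 := by simp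
  rw [hp]
  refine Finset.prod_le_prod (fun _ _ => by positivity) fun j hj => ?_
  have hj : j + 1 ≤ n := Finset.mem_range.1 hj
  rw [show n - 1 - j = n - (j + 1) by omega, Nat.cast_sub hj]
  push_cast
  have hn : (1 : ℝ) ≤ n := by exact_mod_cast (by omega : 1 ≤ n)
  calc (x * (x + 1) + 2 * j) * (x * (x + 1) + 2 * (n - (j + 1)))
      ≤ (x * (x + 1) + (n - 1)) ^ 2 := by
        nlinarith [sq_nonneg ((j : ℝ) - (n - (j + 1)))]
    _ ≤ ((x + 1) ^ 2 + n) ^ 2 := by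
      have : 0 ≤ x * (x + 1) := by positivity
      exact pow_le_pow_left₀ (by linarith) (by nlinarith) 2

/-- The surplus factor `n` makes all terms but the leading one in the binomial expansion of the
`edgeProd` bound contribute `O(1/n)`. -/
theorem mul_descFactorial_le (n r : ℕ) :
    n * n.descFactorial (r + 1) ≤ (2 * n).descFactorial (2 * (r + 1)) := by
  induction r with
  | zero =>
    rcases Nat.eq_zero_or_pos n with rfl | hn
    · simp
    · simp only [zero_add, mul_one, Nat.descFactorial_succ, Nat.descFactorial_zero, tsub_zero]
      calc n * n ≤ (2 * n - 1) * (2 * n) := Nat.mul_le_mul (by omega) (by omega)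
        _ = _ := by rfl
  | succ r ih =>
    rw [show 2 * (r + 1 + 1) = 2 * (r + 1) + 1 + 1 by ring, Nat.descFactorial_succ,
      Nat.descFactorial_succ (2 * n), Nat.descFactorial_succ (2 * n), ← mul_assoc (2 * n - _)]
    calc n * ((n - (r + 1)) * n.descFactorial (r + 1))
        = (n - (r + 1)) * (n * n.descFactorial (r + 1)) := by ring
      _ ≤ ((2 * n - (2 * (r + 1) + 1)) * (2 * n - 2 * (r + 1))) *
          (2 * n).descFactorial (2 * (r + 1)) := by
        refine Nat.mul_le_mul ?_ ih
        rcases Nat.eq_zero_or_pos (n - (r + 1)) with h | h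
        · rw [h]; exact Nat.zero_le _
        · calc n - (r + 1) = 1 * (n - (r + 1)) := (one_mul _).symm
            _ ≤ _ := Nat.mul_le_mul (by omega) (by omega)

open Nat in
theorem choose_mul_factorial_div_le {n r : ℕ} (hn : 0 < n) (hr : r + 1 ≤ n) :
    (n.choose (r + 1) : ℝ) * ((2 * (n - (r + 1)))! / (2 * n)!) ≤ 1 / ((r + 1)! * n) := by
  have h1 : ((2 * (n - (r + 1)))! : ℝ) * (2 * n).descFactorial (2 * (r + 1)) = (2 * n)! := by
    rw [show 2 * (n - (r + 1)) = 2 * n - 2 * (r + 1) by omega]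
    exact_mod_cast Nat.factorial_mul_descFactorial (by omega : 2 * (r + 1) ≤ 2 * n)
  have h2 : (n.descFactorial (r + 1) : ℝ) = (r + 1)! * n.choose (r + 1) := by
    exact_mod_cast Nat.descFactorial_eq_factorial_mul_choose n (r + 1)
  have h3 : (n : ℝ) * n.descFactorial (r + 1) ≤ (2 * n).descFactorial (2 * (r + 1)) := by
    exact_mod_cast mul_descFactorial_le n r
  have hn' : (0 : ℝ) < n := by exact_mod_cast hn
  rw [h2] at h3
  rw [mul_div_assoc', div_le_div_iff₀ (by positivity) (by positivity), ← h1]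
  have h4 : (0 : ℝ) < (2 * (n - (r + 1)))! := by positivity
  nlinarith

open Nat Real in
theorem sum_choose_mul_factorial_div_le {n : ℕ} (hn : 0 < n) (b : ℝ) (hb : 0 ≤ b) :
    ∑ r ∈ Finset.range (n + 1), b ^ r * (n.choose r * ((2 * (n - r))! / (2 * n)!)) ≤
      1 + exp b / n := by
  have hn' : (0 : ℝ) < n := by exact_mod_cast hn
  have h0 : ((2 * n)! : ℝ) ≠ 0 := by positivity
  rw [Finset.sum_range_succ', add_comm]
  simp only [pow_zero, Nat.choose_zero_right, Nat.cast_one, tsub_zero, div_self h0, mul_one]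
  gcongr
  have hle := Real.sum_le_exp_of_nonneg hb (n + 1)
  rw [Finset.sum_range_succ'] at hle
  rw [le_div_iff₀ hn', Finset.sum_mul]
  refine (Finset.sum_le_sum fun r hr => ?_).trans ((le_add_of_nonneg_right (by positivity)).trans hle)
  have hr : r + 1 ≤ n := Finset.mem_range.1 hr
  calc _ ≤ b ^ (r + 1) * (1 / ((r + 1)! * n)) * n := by
        gcongr
        exact choose_mul_factorial_div_le hn hr
    _ = _ := by field_simp

open Nat Real in
theorem tsum_edgeProd_le {n : ℕ} (hn : 0 < n) {a S : ℝ} (ha : 0 < a)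
    (hS : HasSum (fun k : ℕ => edgeProd n k * exp (-a) ^ k) S) :
    S ≤ exp (2 * a) * ((2 * n)! / a ^ (2 * n + 1)) * (1 + exp (n * a ^ 2) / n) := by
  have hterm : ∀ k : ℕ, edgeProd n k * exp (-a) ^ k ≤ ∑ r ∈ Finset.range (n + 1),
      (n : ℝ) ^ r * n.choose r * (((k : ℝ) + 1) ^ (2 * (n - r)) * exp (-a) ^ k) := by
    intro k
    calc _ ≤ (((k : ℝ) + 1) ^ 2 + n) ^ n * exp (-a) ^ k := by
          gcongr
          exact edgeProd_le n k.cast_nonneg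
      _ = _ := by
        rw [add_comm, add_pow, Finset.sum_mul]
        refine Finset.sum_congr rfl fun r _ => ?_
        rw [pow_mul]
        ring
  have hsum : HasSum (fun k : ℕ => ∑ r ∈ Finset.range (n + 1),
      (n : ℝ) ^ r * n.choose r * (((k : ℝ) + 1) ^ (2 * (n - r)) * exp (-a) ^ k))
      (∑ r ∈ Finset.range (n + 1), (n : ℝ) ^ r * n.choose r *
        ∑' k : ℕ, ((k : ℝ) + 1) ^ (2 * (n - r)) * exp (-a) ^ k) :=
    hasSum_sum fun r _ => ((summable_succ_pow_mul_exp _ ha).hasSum).mul_left _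
  refine (hasSum_le hterm hS hsum).trans ?_
  calc _ ≤ ∑ r ∈ Finset.range (n + 1), (n : ℝ) ^ r * n.choose r *
        (exp (2 * a) * ((2 * (n - r))! / a ^ (2 * (n - r) + 1))) := by
        gcongr with r
        exact tsum_succ_pow_mul_exp_le _ ha
    _ = exp (2 * a) * ((2 * n)! / a ^ (2 * n + 1)) * ∑ r ∈ Finset.range (n + 1),
        (n * a ^ 2) ^ r * (n.choose r * ((2 * (n - r))! / (2 * n)!)) := by
        rw [Finset.mul_sum]
        refine Finset.sum_congr rfl fun r hr => ?_
        have hr : r ≤ n := Nat.lt_succ_iff.1 (Finset.mem_range.1 hr)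
        have e : a ^ (2 * n + 1) = a ^ (2 * (n - r) + 1) * (a ^ 2) ^ r := by
          rw [← pow_mul, ← pow_add]
          congr 1
          omega
        rw [e]
        field_simp
        ring
    _ ≤ _ := by
        gcongr
        exact sum_choose_mul_factorial_div_le hn _ (by positivity)

open Nat Real in
theorem le_tsum_edgeProd {n : ℕ} {a S : ℝ} (ha : 0 < a)
    (hS : HasSum (fun k : ℕ => edgeProd n k * exp (-a) ^ k) S) :
    exp (-a) * ((2 * n)! / a ^ (2 * n + 1)) ≤ S := by
  -- Dropping the term `k = 0` shifts the bound `k ^ (2n)` to `(k + 1) ^ (2n)`, at the price of the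
  -- factor `exp (-a)`.
  have h1 := (hasSum_nat_add_iff' 1).2 hS
  have h2 : S - ∑ i ∈ Finset.range 1, edgeProd n i * exp (-a) ^ i ≤ S := by
    have := edgeProd_nonneg n (x := (0 : ℕ)) (by simp)
    simpa using this
  refine le_trans ?_ h2
  refine le_trans ?_ (hasSum_le (fun k => ?_)
    (((summable_succ_pow_mul_exp (2 * n) ha).hasSum).mul_left (exp (-a))) h1)
  · gcongr
    exact le_tsum_succ_pow_mul_exp _ ha
  · have := pow_le_edgeProd n (x := ((k + 1 : ℕ) : ℝ)) (by positivity)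
    rw [pow_succ]
    push_cast at this ⊢
    have h := mul_le_mul_of_nonneg_right this (by positivity : 0 ≤ exp (-a) * exp (-a) ^ k)
    linarith

/-! ### Asymptotics of the exponential averages -/

section asymptotics
open Real

theorem abs_sinh_sub_le {x : ℝ} (hx : |x| ≤ 1) : |sinh x - (x + x ^ 3 / 6)| ≤ |x| ^ 4 := by
  have h1 := Real.exp_bound hx (n := 4) (by norm_num)
  have h2 := Real.exp_bound (x := -x) (by simpa using hx) (n := 4) (by norm_num)
  have h0 : 0 ≤ |x| ^ 4 := by positivity
  simp only [Finset.sum_range_succ, Finset.sum_range_zero, Nat.factorial, abs_neg] at h1 h2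
  norm_num at h1 h2
  rw [abs_le] at h1 h2 ⊢
  rw [Real.sinh_eq]
  constructor <;> nlinarith [h1.1, h1.2, h2.1, h2.2]

theorem tendsto_sinh_sub_div_cube :
    Tendsto (fun x : ℝ => (sinh x - x) / x ^ 3) (𝓝[>] 0) (𝓝 (1 / 6)) := by
  rw [tendsto_iff_norm_sub_tendsto_zero]
  refine squeeze_zero' (Eventually.of_forall fun x => norm_nonneg _) ?_
    (tendsto_id'.2 (nhdsWithin_le_nhds : 𝓝[>] (0 : ℝ) ≤ 𝓝 0))
  filter_upwards [Ioo_mem_nhdsGT (zero_lt_one (α := ℝ))] with x hx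
  have hx0 : 0 < x := hx.1
  have h := abs_sinh_sub_le (x := x) (by rw [abs_of_pos hx.1]; exact hx.2.le)
  rw [abs_of_pos hx.1] at h
  have e : (sinh x - x) / x ^ 3 - 1 / 6 = (sinh x - (x + x ^ 3 / 6)) / x ^ 3 := by
    field_simp
    ring
  rw [e, Real.norm_eq_abs, abs_div, abs_of_pos (by positivity : 0 < x ^ 3),
    div_le_iff₀ (by positivity)]
  calc _ ≤ _ := h
    _ = _ := by simp only [id]; ring

theorem tendsto_div_sqrt_nhdsGT {s : ℝ} (hs : 0 < s) :
    Tendsto (fun n : ℕ => s / √n) atTop (𝓝[>] 0) := by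
  rw [tendsto_nhdsWithin_iff]
  constructor
  · exact (Real.tendsto_sqrt_atTop.comp tendsto_natCast_atTop_atTop).const_div_atTop s
  · filter_upwards [eventually_gt_atTop 0] with n hn
    have : (0 : ℝ) < n := by exact_mod_cast hn
    exact div_pos hs (Real.sqrt_pos.2 this)

/-- With `x = s / √n`, `sinh x / x = 1 + x² / 6 + o(x²)`, and `2n * x² / 6 = s² / 3`. -/
theorem tendsto_sinh_div_pow {s : ℝ} (hs : 0 < s) :
    Tendsto (fun n : ℕ => (sinh (s / √n) / (s / √n)) ^ (2 * n + 1)) atTop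
      (𝓝 (exp (s ^ 2 / 3))) := by
  have hx := tendsto_div_sqrt_nhdsGT hs
  have hpos : ∀ᶠ n : ℕ in atTop, 0 < s / √n :=
    (tendsto_nhdsWithin_iff.1 hx).2
  have hn : Tendsto (fun n : ℕ => (n : ℝ) * ((sinh (s / √n) - s / √n) / (s / √n))) atTop
      (𝓝 (s ^ 2 * (1 / 6))) := by
    refine ((tendsto_sinh_sub_div_cube.comp hx).const_mul (s ^ 2)).congr' ?_
    filter_upwards [eventually_gt_atTop 0] with n hn
    have hn' : (0 : ℝ) < n := by exact_mod_cast hn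
    have hsq : √(n : ℝ) ^ 2 = n := Real.sq_sqrt hn'.le
    have hs0 : 0 < √(n : ℝ) := Real.sqrt_pos.2 hn'
    have e : (n : ℝ) * (s / √n) ^ 2 = s ^ 2 := by
      rw [div_pow, hsq]; field_simp
    simp only [Function.comp_apply]
    rw [← e]
    have : s / √(n : ℝ) ≠ 0 := by positivity
    generalize s / √(n : ℝ) = x at *
    field_simp
  have h1 := Real.tendsto_one_add_pow_exp_of_tendsto hn
  have h2 : Tendsto (fun n : ℕ => 1 + (sinh (s / √n) - s / √n) / (s / √n)) atTop (𝓝 1) := by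
    have h := hn.mul tendsto_inv_atTop_nhds_zero_nat
    rw [mul_zero] at h
    have h' := (h.congr' (f₂ := fun n : ℕ => (sinh (s / √n) - s / √n) / (s / √n)) (by
      filter_upwards [eventually_gt_atTop 0] with n hn
      have hn' : (n : ℝ) ≠ 0 := by exact_mod_cast hn.ne'
      field_simp)).const_add 1
    simpa using h'
  have h3 := (h1.pow 2).mul h2
  rw [← Real.exp_nat_mul, mul_one] at h3
  convert! h3.congr' ?_ using 2
  · push_cast; congr 1; ring
  · filter_upwards [hpos] with n hn
    have : 1 + (sinh (s / √n) - s / √n) / (s / √n) = sinh (s / √n) / (s / √n) := by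
      generalize s / √(n : ℝ) = x at *
      field_simp
      ring
    rw [this]
    ring

/-- Since `(1 - exp (-a)) / a = exp (-a/2) * sinh (a/2) / (a/2)`, centring leaves only `exp ((c -
1/2) * a) → 1`. The free `c` serves the lower bound (`-1`) and the upper bound (`2`). -/
theorem tendsto_sinh_half_div_pow_mul_exp {s : ℝ} (hs : 0 < s) (c : ℝ) :
    Tendsto (fun n : ℕ => exp (c * (s / √n)) *
      (((1 - exp (-(s / √n))) / (s / √n)) ^ (2 * n + 1) * exp (s / √n * n))) atTop
      (𝓝 (exp (s ^ 2 / 12))) := by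
  have h0 : Tendsto (fun n : ℕ => s / √n) atTop (𝓝 0) :=
    (tendsto_nhdsWithin_iff.1 (tendsto_div_sqrt_nhdsGT hs)).1
  have h1 : Tendsto (fun n : ℕ => exp ((c - 1 / 2) * (s / √n))) atTop (𝓝 1) := by
    have := (Real.continuous_exp.tendsto _).comp (h0.const_mul (c - 1 / 2))
    simpa [Function.comp_def] using this
  have h2 := h1.mul (tendsto_sinh_div_pow (half_pos hs))
  rw [one_mul, show (s / 2) ^ 2 / 3 = s ^ 2 / 12 by ring] at h2
  refine h2.congr fun n => ?_
  rw [show s / 2 / √(n : ℝ) = s / √n / 2 by ring]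
  generalize s / √(n : ℝ) = a
  have e1 : sinh (a / 2) / (a / 2) = (1 - exp (-a)) / a * exp (a / 2) := by
    have : exp (-a) = exp (-(a / 2)) * exp (-(a / 2)) := by rw [← Real.exp_add]; ring_nf
    have h' : exp (-(a / 2)) * exp (a / 2) = 1 := by rw [← Real.exp_add]; simp
    rw [Real.sinh_eq, this, div_div_eq_mul_div, div_mul_cancel₀ _ (two_ne_zero (α := ℝ)), div_mul_eq_mul_div]
    congr 1
    linear_combination exp (-(a / 2)) * h'
  have e2 : exp (c * a) = exp ((c - 1 / 2) * a) * exp (a / 2) := by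
    rw [← Real.exp_add]; ring_nf
  have e3 : exp (a / 2) ^ (2 * n + 1) = exp (a / 2) * exp (a * n) := by
    rw [← Real.exp_nat_mul, ← Real.exp_add]; push_cast; ring_nf
  rw [e1, mul_pow, e2, e3]
  ring

theorem average_exp_bounds {n : ℕ} (hn : 0 < n) (d : Equiv.Perm (Fin (2 * n)) → ℕ)
    (hd : ∀ σ, d σ ≤ 2 * n)
    (hsum : ∀ x : ℝ, ∑ σ ∈ matchingFinset n, ∏ i ∈ Finset.range (2 * n), (x + 1 - d σ + i) =
      (matchingFinset n).card * edgeProd n x) {a : ℝ} (ha : 0 < a) :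
    exp (-a) * ((1 - exp (-a)) / a) ^ (2 * n + 1) ≤
        (∑ σ ∈ matchingFinset n, exp (-a) ^ d σ) / (matchingFinset n).card ∧
      (∑ σ ∈ matchingFinset n, exp (-a) ^ d σ) / (matchingFinset n).card ≤
        exp (2 * a) * ((1 - exp (-a)) / a) ^ (2 * n + 1) * (1 + exp (n * a ^ 2) / n) := by
  have ht : exp (-a) < 1 := by simpa using ha
  have hS := hasSum_edgeProd d hd hn hsum (t := exp (-a))
    (by rwa [abs_of_pos (exp_pos _)])
  have hl := le_tsum_edgeProd ha hS
  have hu := tsum_edgeProd_le hn ha hS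
  have h1 : 0 < 1 - exp (-a) := by linarith
  generalize (∑ σ ∈ matchingFinset n, exp (-a) ^ d σ) / ((matchingFinset n).card : ℝ) = E at *
  have hf : (0 : ℝ) < (2 * n).factorial := by positivity
  have hc : 0 < (1 - exp (-a)) ^ (2 * n + 1) / (2 * n).factorial := by positivity
  have hl' := mul_le_mul_of_nonneg_left hl hc.le
  have hu' := mul_le_mul_of_nonneg_left hu hc.le
  have eE : (1 - exp (-a)) ^ (2 * n + 1) / (2 * n).factorial *
      ((2 * n).factorial / (1 - exp (-a)) ^ (2 * n + 1) * E) = E := by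
    field_simp
  rw [eE] at hl' hu'
  constructor
  · refine le_trans (le_of_eq ?_) hl'
    rw [div_pow]
    field_simp
  · refine hu'.trans (le_of_eq ?_)
    rw [div_pow]
    field_simp

theorem tendsto_average_exp (d : ∀ n, Equiv.Perm (Fin (2 * n)) → ℕ)
    (hd : ∀ n σ, d n σ ≤ 2 * n)
    (hsum : ∀ n, 0 < n → ∀ x : ℝ,
      ∑ σ ∈ matchingFinset n, ∏ i ∈ Finset.range (2 * n), (x + 1 - d n σ + i) =
        (matchingFinset n).card * edgeProd n x) {s : ℝ} (hs : 0 < s) :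
    Tendsto (fun n : ℕ => (∑ σ ∈ matchingFinset n, exp (-(s / √n)) ^ d n σ) /
      (matchingFinset n).card * exp (s / √n * n)) atTop (𝓝 (exp (s ^ 2 / 12))) := by
  have hl := tendsto_sinh_half_div_pow_mul_exp hs (-1)
  have hu := (tendsto_sinh_half_div_pow_mul_exp hs 2).mul
    ((tendsto_const_div_atTop_nhds_zero_nat (exp (s ^ 2))).const_add 1)
  rw [add_zero, mul_one] at hu
  have hev : ∀ᶠ n : ℕ in atTop, 0 < n := eventually_gt_atTop 0
  refine tendsto_of_tendsto_of_tendsto_of_le_of_le' hl hu ?_ ?_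
  · filter_upwards [hev] with n hn
    have hn' : (0 : ℝ) < n := by exact_mod_cast hn
    have ha : 0 < s / √n := div_pos hs (Real.sqrt_pos.2 hn')
    have h := (average_exp_bounds hn (d n) (hd n) (hsum n hn) ha).1
    have h' := mul_le_mul_of_nonneg_right h (exp_pos (s / √n * n)).le
    rw [neg_one_mul]
    rwa [mul_assoc] at h'
  · filter_upwards [hev] with n hn
    have hn' : (0 : ℝ) < n := by exact_mod_cast hn
    have ha : 0 < s / √n := div_pos hs (Real.sqrt_pos.2 hn')
    have h := (average_exp_bounds hn (d n) (hd n) (hsum n hn) ha).2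
    have h' := mul_le_mul_of_nonneg_right h (exp_pos (s / √n * n)).le
    have e : (n : ℝ) * (s / √n) ^ 2 = s ^ 2 := by
      rw [div_pow, Real.sq_sqrt hn'.le]; field_simp
    rw [e] at h'
    refine h'.trans (le_of_eq ?_)
    ring

end asymptotics

/-! ### Limit of the moment generating functions -/

theorem coe_matchingFinset (n : ℕ) : (matchingFinset n : Set (Equiv.Perm (Fin (2 * n)))) =
    matchings n := by
  ext σ
  simp [matchings, mem_matchingFinset]

theorem integral_uniformMatching (n : ℕ) (f : Equiv.Perm (Fin (2 * n)) → ℝ) :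
    ∫ σ, f σ ∂uniformMatching n = (∑ σ ∈ matchingFinset n, f σ) / (matchingFinset n).card := by
  rw [uniformMatching, uniformOn, ProbabilityTheory.cond, integral_smul_measure,
    ← coe_matchingFinset, setIntegral_finset _ Integrable.of_finite.integrableOn,
    Measure.count_apply_finset]
  simp [div_eq_inv_mul]

theorem tendsto_mgf_normalizedDescents (s : ℝ) :
    Tendsto (fun n => mgf (normalizedDescents n) (uniformMatching n) s) atTop
      (𝓝 (Real.exp (s ^ 2 / 12))) := by
  simp only [mgf, integral_uniformMatching]
  rcases lt_trichotomy s 0 with hs | rfl | hs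
  · have h := tendsto_average_exp (fun n σ => numDescents σ) (fun n σ => numDescents_le_two_mul σ)
      (fun n hn => sum_prod_numDescents hn) (neg_pos.2 hs)
    rw [neg_sq] at h
    refine h.congr fun n => ?_
    rw [div_mul_eq_mul_div, Finset.sum_mul]
    congr 1
    refine Finset.sum_congr rfl fun σ _ => ?_
    rw [← Real.exp_nat_mul, ← Real.exp_add, normalizedDescents]
    congr 1
    ring
  · refine tendsto_const_nhds.congr' ?_
    filter_upwards [eventually_gt_atTop 0] with n hn
    have := (card_matchingFinset_pos hn).ne'
    simp [this]
  · have h := tendsto_average_exp (fun n σ => 2 * n - numDescents σ) (fun n σ => Nat.sub_le _ _)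
      (fun n hn => sum_prod_two_mul_sub_numDescents hn) hs
    refine h.congr fun n => ?_
    rw [div_mul_eq_mul_div, Finset.sum_mul]
    congr 1
    refine Finset.sum_congr rfl fun σ _ => ?_
    rw [← Real.exp_nat_mul, ← Real.exp_add, normalizedDescents,
      Nat.cast_sub (numDescents_le_two_mul σ)]
    congr 1
    push_cast
    ring

/-! ### Curtiss' theorem -/

section curtiss
open Real

theorem exp_sub_min_le (y : ℝ) {K : ℝ} (hK : 0 < K) :
    exp y - min (exp y) K ≤ exp (2 * y) / K := by
  rw [two_mul, Real.exp_add, le_div_iff₀ hK]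
  have := exp_pos y
  rcases le_total (exp y) K with h | h
  · rw [min_eq_left h, sub_self, zero_mul]
    positivity
  · rw [min_eq_right h]
    nlinarith

/-- Chernoff bounds at `1` and `-1` control the two tails uniformly in `n`. -/
theorem isTightMeasureSet_of_mgf_le {μ : ℕ → ProbabilityMeasure ℝ}
    (hint : ∀ n s, Integrable (fun x => exp (s * x)) (μ n : Measure ℝ))
    {C₁ C₂ : ℝ} (h1 : ∀ n, mgf id (μ n : Measure ℝ) 1 ≤ C₁)
    (h2 : ∀ n, mgf id (μ n : Measure ℝ) (-1) ≤ C₂) :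
    IsTightMeasureSet {((μ n : ProbabilityMeasure ℝ) : Measure ℝ) | n} := by
  refine isTightMeasureSet_of_tendsto_measure_norm_gt ?_
  have hlim : Tendsto (fun r : ℝ => ENNReal.ofReal (exp (-r) * (C₁ + C₂))) atTop (𝓝 0) := by
    rw [← ENNReal.ofReal_zero]
    refine ENNReal.tendsto_ofReal ?_
    simpa using Real.tendsto_exp_neg_atTop_nhds_zero.mul_const (C₁ + C₂)
  refine tendsto_of_tendsto_of_tendsto_of_le_of_le tendsto_const_nhds hlim (fun _ => zero_le)
    fun r => ?_
  refine iSup₂_le ?_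
  rintro _ ⟨n, rfl⟩
  have hsub : {x : ℝ | r < ‖x‖} ⊆ {x | r ≤ id x} ∪ {x | id x ≤ -r} := by
    intro x (hx : r < |x|)
    rcases lt_abs.1 hx with h | h
    · exact Or.inl h.le
    · exact Or.inr (by simp only [id, Set.mem_ofPred_eq]; linarith)
  have b1 := measure_ge_le_exp_mul_mgf (μ := (μ n : Measure ℝ)) (X := id) r zero_le_one
    (hint n 1)
  have b2 := measure_le_le_exp_mul_mgf (μ := (μ n : Measure ℝ)) (X := id) (-r)
    (neg_nonpos.2 zero_le_one) (hint n (-1))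
  have h : (μ n : Measure ℝ).real {x : ℝ | r < ‖x‖} ≤ exp (-r) * (C₁ + C₂) := by
    calc _ ≤ (μ n : Measure ℝ).real ({x | r ≤ id x} ∪ {x | id x ≤ -r}) := measureReal_mono hsub
      _ ≤ _ := measureReal_union_le _ _
      _ ≤ exp (-1 * r) * mgf id (μ n : Measure ℝ) 1 +
          exp (- -1 * -r) * mgf id (μ n : Measure ℝ) (-1) := add_le_add b1 b2
      _ ≤ exp (-1 * r) * C₁ + exp (- -1 * -r) * C₂ := by
        gcongr
        exacts [h1 n, h2 n]
      _ = _ := by ring_nf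
  rw [← ofReal_measureReal]
  exact ENNReal.ofReal_le_ofReal h

/-- Truncating `exp (s * x)` at `K` costs at most `C / K`, uniformly in the index, by the bound at
`2 * s`; weak convergence handles the truncation, and then `K → ∞`. -/
theorem mgf_eq_of_tendsto {ι : Type*} {F : Filter ι} [F.NeBot] {μ : ι → ProbabilityMeasure ℝ}
    {ν : ProbabilityMeasure ℝ} (hν : Tendsto μ F (𝓝 ν))
    (hint : ∀ n s, Integrable (fun x => exp (s * x)) (μ n : Measure ℝ))
    {s C L : ℝ} (hC : ∀ n, mgf id (μ n : Measure ℝ) (2 * s) ≤ C)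
    (hL : Tendsto (fun n => mgf id (μ n : Measure ℝ) s) F (𝓝 L)) :
    mgf id (ν : Measure ℝ) s = L := by
  have hL0 : 0 ≤ L := ge_of_tendsto' hL fun n => mgf_nonneg
  let g : ℕ → BoundedContinuousFunction ℝ ℝ := fun K =>
    BoundedContinuousFunction.ofNormedAddCommGroup (fun x => min (exp (s * x)) K)
      (by fun_prop) K (fun x => by
        rw [Real.norm_of_nonneg (le_min (exp_pos _).le K.cast_nonneg)]
        exact min_le_right _ _)
  have hg : ∀ K x, g K x = min (exp (s * x)) K := fun K x => rfl
  have hclose : ∀ K : ℕ, 0 < K → ∀ n,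
      |mgf id (μ n : Measure ℝ) s - ∫ x, g K x ∂(μ n : Measure ℝ)| ≤ C / K := by
    intro K hK n
    have hK' : (0 : ℝ) < K := by exact_mod_cast hK
    have hi : Integrable (fun x => exp (s * x)) (μ n : Measure ℝ) := hint n s
    have hgi := (g K).integrable (μ n : Measure ℝ)
    have e : mgf id (μ n : Measure ℝ) s - ∫ x, g K x ∂(μ n : Measure ℝ) =
        ∫ x, (exp (s * x) - g K x) ∂(μ n : Measure ℝ) := by
      rw [integral_sub hi hgi]
      rfl
    rw [e, abs_of_nonneg (integral_nonneg fun x => sub_nonneg.2 (min_le_left _ _))]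
    calc _ ≤ ∫ x, exp (2 * s * x) / K ∂(μ n : Measure ℝ) := by
          refine integral_mono (hi.sub hgi) ((hint n (2 * s)).div_const _) fun x => ?_
          have := exp_sub_min_le (s * x) hK'
          rwa [← mul_assoc] at this
      _ = mgf id (μ n : Measure ℝ) (2 * s) / K := by rw [integral_div]; rfl
      _ ≤ _ := by gcongr; exact hC n
  have hclose' : ∀ K : ℕ, 0 < K → |L - ∫ x, g K x ∂(ν : Measure ℝ)| ≤ C / K := by
    intro K hK
    have h1 := (ProbabilityMeasure.tendsto_iff_forall_integral_tendsto.1 hν) (g K)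
    exact le_of_tendsto' (hL.sub h1).abs (hclose K hK)
  have hlim : Tendsto (fun K : ℕ => ∫ x, g K x ∂(ν : Measure ℝ)) atTop (𝓝 L) := by
    rw [tendsto_iff_norm_sub_tendsto_zero]
    refine squeeze_zero' (Eventually.of_forall fun _ => norm_nonneg _) ?_
      (tendsto_const_div_atTop_nhds_zero_nat C)
    filter_upwards [eventually_gt_atTop 0] with K hK
    rw [Real.norm_eq_abs, abs_sub_comm]
    exact hclose' K hK
  -- Monotone convergence for the lower integral avoids assuming that `exp (s * x)` is integrable
  -- under `ν`.
  have hmono : Tendsto (fun K : ℕ => ∫⁻ x, ENNReal.ofReal (g K x) ∂(ν : Measure ℝ)) atTop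
      (𝓝 (∫⁻ x, ENNReal.ofReal (exp (s * x)) ∂(ν : Measure ℝ))) := by
    refine lintegral_tendsto_of_tendsto_of_monotone
      (fun K => (g K).continuous.measurable.ennreal_ofReal.aemeasurable)
      (ae_of_all _ fun x K K' h => ?_) (ae_of_all _ fun x => ?_)
    · exact ENNReal.ofReal_le_ofReal (min_le_min_left _ (by exact_mod_cast h))
    · refine ENNReal.tendsto_ofReal (tendsto_const_nhds.congr' ?_)
      filter_upwards [eventually_ge_atTop ⌈exp (s * x)⌉₊] with K hK
      exact (min_eq_left (Nat.ceil_le.1 hK)).symm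
  have heq : ∫⁻ x, ENNReal.ofReal (exp (s * x)) ∂(ν : Measure ℝ) = ENNReal.ofReal L := by
    refine tendsto_nhds_unique hmono ((ENNReal.tendsto_ofReal hlim).congr fun K => ?_)
    exact ofReal_integral_eq_lintegral_ofReal ((g K).integrable _)
      (ae_of_all _ fun x => le_min (exp_pos _).le K.cast_nonneg)
  rw [mgf, integral_eq_lintegral_of_nonneg_ae (ae_of_all _ fun x => (exp_pos _).le)
    (by fun_prop)]
  simp only [id, heq, ENNReal.toReal_ofReal hL0]

/-- **Curtiss' theorem** for moment generating functions that are finite everywhere. -/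
theorem tendsto_of_tendsto_mgf {μ : ℕ → ProbabilityMeasure ℝ} {μ₀ : ProbabilityMeasure ℝ}
    (hint : ∀ n s, Integrable (fun x => exp (s * x)) (μ n : Measure ℝ))
    (hint₀ : ∀ s, Integrable (fun x => exp (s * x)) (μ₀ : Measure ℝ))
    (h : ∀ s, Tendsto (fun n => mgf id (μ n : Measure ℝ) s) atTop
      (𝓝 (mgf id (μ₀ : Measure ℝ) s))) :
    Tendsto μ atTop (𝓝 μ₀) := by
  have hbdd : ∀ s, ∃ C, ∀ n, mgf id (μ n : Measure ℝ) s ≤ C := fun s => by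
    obtain ⟨C, hC⟩ := (h s).bddAbove_range
    exact ⟨C, fun n => hC ⟨n, rfl⟩⟩
  obtain ⟨C₁, h1⟩ := hbdd 1
  obtain ⟨C₂, h2⟩ := hbdd (-1)
  have htight := isTightMeasureSet_of_mgf_le hint h1 h2
  -- By tightness every ultrafilter has a weak limit `ν`. It has the moment generating function of
  -- `μ₀`, finite everywhere, and analytic continuation to the complex plane forces `ν = μ₀`.
  refine (Filter.tendsto_iff_ultrafilter _ _ _).2 fun U hU => ?_
  have hcompact : IsCompact (closure {μ n | n}) :=
    isCompact_closure_of_isTightMeasureSet (by simpa using htight)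
  obtain ⟨ν, -, hν : Tendsto _ _ _⟩ := hcompact.ultrafilter_le_nhds (U.map μ)
    (.trans (by simp) (monotone_principal subset_closure))
  have hmgf : mgf id (μ₀ : Measure ℝ) = mgf id (ν : Measure ℝ) := by
    funext s
    obtain ⟨C, hC⟩ := hbdd (2 * s)
    exact (mgf_eq_of_tendsto hν hint hC ((h s).mono_left hU)).symm
  have hset : integrableExpSet id (μ₀ : Measure ℝ) = Set.univ :=
    Set.eq_univ_of_forall hint₀
  have hcomplex : complexMGF id (μ₀ : Measure ℝ) = complexMGF id (ν : Measure ℝ) := by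
    funext z
    exact eqOn_complexMGF_of_mgf hmgf (by simp [hset])
  have : (μ₀ : Measure ℝ) = (ν : Measure ℝ) := Measure.ext_of_complexMGF_id_eq hcomplex
  rwa [Subtype.ext this]

end curtiss

/-! ### The central limit theorem -/

theorem mainTheorem1 {Ω : ℕ → Type*} [∀ n, MeasurableSpace (Ω n)]
    (P : ∀ n, Measure (Ω n)) [∀ n, IsProbabilityMeasure (P n)]
    (π : ∀ n, Ω n → Equiv.Perm (Fin (2 * n)))
    (hπ : ∀ n, HasLaw (π n) (uniformMatching n) (P n))
    {Ω' : Type*} [MeasurableSpace Ω'] (P' : Measure Ω') [IsProbabilityMeasure P']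
    (W : Ω' → ℝ) (hW : HasLaw W (gaussianReal 0 (1 / 6)) P') :
    (∀ s : ℝ, Tendsto (fun n => mgf (fun ω => normalizedDescents n (π n ω)) (P n) s) atTop
      (𝓝 (mgf W P' s))) ∧
    TendstoInDistribution (fun n ω => normalizedDescents n (π n ω)) atTop W P P' := by
  have hmgf : ∀ s : ℝ, Tendsto (fun n => mgf (fun ω => normalizedDescents n (π n ω)) (P n) s)
      atTop (𝓝 (mgf W P' s)) := by
    intro s
    rw [mgf_gaussianReal hW.map_eq]
    convert! tendsto_mgf_normalizedDescents s using 1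
    · funext n
      rw [← (hπ n).map_eq, mgf_map (hπ n).aemeasurable (measurable_of_finite _).aestronglyMeasurable]
      rfl
    · push_cast
      ring_nf
  have hae : ∀ n, AEMeasurable (fun ω => normalizedDescents n (π n ω)) (P n) := fun n =>
    (measurable_of_finite (normalizedDescents n)).comp_aemeasurable (hπ n).aemeasurable
  refine ⟨hmgf, hae, hW.aemeasurable, ?_⟩
  refine tendsto_of_tendsto_mgf (fun n s => ?_) (fun s => ?_) fun s => ?_
  · have : IsProbabilityMeasure (uniformMatching n) := by
      rw [← (hπ n).map_eq]
      exact Measure.isProbabilityMeasure_map (hπ n).aemeasurable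
    rw [ProbabilityMeasure.coe_mk, integrable_map_measure (by fun_prop) (hae n)]
    have h : Integrable (fun σ => Real.exp (s * normalizedDescents n σ)) ((P n).map (π n)) := by
      rw [(hπ n).map_eq]
      exact Integrable.of_finite
    exact h.comp_aemeasurable (hπ n).aemeasurable
  · simp only [ProbabilityMeasure.coe_mk, hW.map_eq]
    exact integrable_exp_mul_gaussianReal s
  · simp only [ProbabilityMeasure.coe_mk, mgf_id_map (hae _), mgf_id_map hW.aemeasurable]
    exact hmgf s
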